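/- **Setting.** An FSAP/FBAP instance consists of a number $W\ge 1$ of colors (resource units) and $n\ge 0$ jobs; job $i$ has a half-open time interval $[s_i,e_i)$ with $0\le s_i<e_i$, a maximum amount $r_{\max}(i)\in\mathbb N$ and a profit $p_i\ge 1$ per unit. A feasible FBAP solution assigns to each job $i$ a set $c(i)\subseteq\{1,\dots,W\}$ with $|c(i)|\le r_{\max}(i)$, such that jobs whose intervals intersect get disjoint sets. A feasible FSAP solution is a feasible FBAP solution in which every $c(i)$ is a (possibly empty) block of consecutive colors. In both problems the goal is to maximize the profit $\sum_i p_i|c(i)|$. The interval graph $G$ has the jobs as vertices, two distinct jobs being adjacent when their intervals intersect. An instance is uniform with parameter $\mathtt{Max}$ if $1\le \mathtt{Max}\le W$ and $r_{\max}(i)=\mathtt{Max}$, $p_i=1$ for all $i$. **Lemma.** (1) Consider a uniform instance with parameter $\mathtt{Max}$ in which $W$ is a multiple of $\mathtt{Max}$, and put $k=W/\mathtt{Max}$. (a) There is an optimal FBAP solution in which every job gets either $0$ or $\mathtt{Max}$ colors. (b) Let $S$ be a set of jobs that induces a $k$-colorable subgraph of $G$ with the maximum number of vertices. Then there is a feasible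 FSAP solution that gives each job in $S$ a block of $\mathtt{Max}$ contiguous colors and all other jobs no color, and every such solution is an optimal FSAP solution and also an optimal FBAP solution. (2) FSAP on uniform instances in which $W$ is a multiple of $\mathtt{Max}$ can be solved exactly in polynomial time: there are one algorithm and one polynomial $P$ such that for every such instance with rational endpoints, given by $n$, $W$, $\mathtt{Max}$ and the endpoints as fractions of natural numbers, all in binary, the algorithm computes an optimal FSAP solution (for each job, the first color and the length of its block) in time at most $P(L)$, where $L$ is the bit length of the input. Time is measured on a random access machine over the natural numbers with addition, truncated subtraction, multiplication, integer division, comparison and indirect addressing, under the logarithmic cost criterion (each operation is charged the bit lengths of the numbers and addresses that it handles). -/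

import Mathlib

/-! ## Flexible storage and bandwidth allocation -/

/-- An instance with `n` jobs: `W` units of resource (colors), and for the `i`-th job the half-open
time interval `[s i, e i)`, the maximum amount `rmax i`, and the profit `p i` per allocated unit. -/
structure AllocInstance (n : ℕ) where
  W : ℕ
  W_pos : 0 < W
  s : Fin n → ℝ
  e : Fin n → ℝ
  s_nonneg : ∀ i, 0 ≤ s i
  s_lt_e : ∀ i, s i < e i
  rmax : Fin n → ℕ
  p : Fin n → ℝ
  one_le_p : ∀ i, 1 ≤ p i

namespace AllocInstance

variable {n : ℕ}

/-- The interval graph: distinct jobs are adjacent when their intervals intersect. -/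
def graph (I : AllocInstance n) : SimpleGraph (Fin n) where
  Adj i j := i ≠ j ∧ (Set.Ico (I.s i) (I.e i) ∩ Set.Ico (I.s j) (I.e j)).Nonempty
  symm := ⟨fun _ _ h => ⟨h.1.symm, by rw [Set.inter_comm]; exact h.2⟩⟩
  loopless := ⟨fun _ h => h.1 rfl⟩

/-- All jobs have maximum amount `Max`, with `1 ≤ Max ≤ W`, and unit profit. -/
def IsUniform (I : AllocInstance n) (Max : ℕ) : Prop :=
  1 ≤ Max ∧ Max ≤ I.W ∧ (∀ i, I.rmax i = Max) ∧ ∀ i, I.p i = 1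

/-- Total profit of a coloring, which gives every job a set of colors. -/
noncomputable def profit (I : AllocInstance n) (c : Fin n → Finset ℕ) : ℝ :=
  ∑ i, I.p i * ((c i).card : ℝ)

/-- Feasibility for bandwidth allocation: each job `i` gets at most `rmax i` of the colors
`1, …, W`, and no color is used by two jobs that are active at a common time. -/
def FBAPFeasible (I : AllocInstance n) (c : Fin n → Finset ℕ) : Prop :=
  (∀ i, c i ⊆ Finset.Icc 1 I.W) ∧ (∀ i, (c i).card ≤ I.rmax i) ∧
    ∀ i j, I.graph.Adj i j → Disjoint (c i) (c j)

/-- A block of consecutive colors (possibly empty). -/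
def IsBlock (B : Finset ℕ) : Prop := ∃ a m : ℕ, B = Finset.Ico a (a + m)

/-- Feasibility for storage allocation: moreover every job gets a contiguous block. -/
def FSAPFeasible (I : AllocInstance n) (c : Fin n → Finset ℕ) : Prop :=
  I.FBAPFeasible c ∧ ∀ i, IsBlock (c i)

def FBAPOptimal (I : AllocInstance n) (c : Fin n → Finset ℕ) : Prop :=
  I.FBAPFeasible c ∧ ∀ c', I.FBAPFeasible c' → I.profit c' ≤ I.profit c

def FSAPOptimal (I : AllocInstance n) (c : Fin n → Finset ℕ) : Prop :=
  I.FSAPFeasible c ∧ ∀ c', I.FSAPFeasible c' → I.profit c' ≤ I.profit c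

/-- The jobs in `S` induce a `k`-colorable subgraph of the interval graph. -/
def ColorableSet (I : AllocInstance n) (k : ℕ) (S : Finset (Fin n)) : Prop :=
  (I.graph.induce (S : Set (Fin n))).Colorable k

/-- The jobs in `S` induce a `k`-colorable subgraph with the maximum number of vertices. -/
def MaxColorableSet (I : AllocInstance n) (k : ℕ) (S : Finset (Fin n)) : Prop :=
  I.ColorableSet k S ∧ ∀ T, I.ColorableSet k T → T.card ≤ S.card

end AllocInstance

/-! ## Random access programs with logarithmic cost -/

namespace Ram

/-- Memory: natural-number variables, and arrays of natural numbers.  A program is a finite text,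
so it mentions only finitely many variables and arrays. -/
structure State where
  var : ℕ → ℕ
  arr : ℕ → ℕ → ℕ

inductive Expr where
  | const (c : ℕ)
  | var (x : ℕ)
  | get (a : ℕ) (i : Expr)
  | add (u v : Expr)
  | sub (u v : Expr)
  | mul (u v : Expr)
  | div (u v : Expr)
  | lt (u v : Expr)

/-- Value of an expression; `sub` is truncated, `div` rounds down, `lt` gives `1` or `0`. -/
def Expr.eval (σ : State) : Expr → ℕ
  | .const c => c
  | .var x => σ.var x
  | .get a i => σ.arr a (i.eval σ)
  | .add u v => u.eval σ + v.eval σ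
  | .sub u v => u.eval σ - v.eval σ
  | .mul u v => u.eval σ * v.eval σ
  | .div u v => u.eval σ / v.eval σ
  | .lt u v => if u.eval σ < v.eval σ then 1 else 0

/-- Logarithmic cost: one step for each node of the expression, and one more for each bit of each
number that occurs as the value of a node (array indices included). -/
def Expr.cost (σ : State) : Expr → ℕ
  | .const c => 1 + c.size
  | .var x => 1 + (σ.var x).size
  | .get a i => i.cost σ + 1 + (σ.arr a (i.eval σ)).size
  | .add u v => u.cost σ + v.cost σ + 1 + (u.eval σ + v.eval σ).size
  | .sub u v => u.cost σ + v.cost σ + 1 + (u.eval σ - v.eval σ).size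
  | .mul u v => u.cost σ + v.cost σ + 1 + (u.eval σ * v.eval σ).size
  | .div u v => u.cost σ + v.cost σ + 1 + (u.eval σ / v.eval σ).size
  | .lt u v => u.cost σ + v.cost σ + 2

/-- Programs: assignment to a variable, to an array cell, sequencing, branching and loops. -/
inductive Cmd where
  | skip
  | assign (x : ℕ) (u : Expr)
  | store (a : ℕ) (i u : Expr)
  | seq (p q : Cmd)
  | ite (b : Expr) (p q : Cmd)
  | loop (b : Expr) (p : Cmd)

def State.setVar (σ : State) (x v : ℕ) : State :=
  { σ with var := Function.update σ.var x v }

def State.setArr (σ : State) (a i v : ℕ) : State :=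
  { σ with arr := Function.update σ.arr a (Function.update (σ.arr a) i v) }

/-- `Run p σ t τ`: started in `σ`, the program `p` halts in `τ` at total cost `t`.  A guard is true
when its value is nonzero. -/
inductive Run : Cmd → State → ℕ → State → Prop where
  | skip (σ : State) : Run .skip σ 1 σ
  | assign (x : ℕ) (u : Expr) (σ : State) :
      Run (.assign x u) σ (u.cost σ + 1) (σ.setVar x (u.eval σ))
  | store (a : ℕ) (i u : Expr) (σ : State) :
      Run (.store a i u) σ (i.cost σ + u.cost σ + 1) (σ.setArr a (i.eval σ) (u.eval σ))
  | seq {p q : Cmd} {σ ρ τ : State} {t t' : ℕ} :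
      Run p σ t ρ → Run q ρ t' τ → Run (.seq p q) σ (t + t') τ
  | ite_true {b : Expr} {p q : Cmd} {σ τ : State} {t : ℕ} :
      b.eval σ ≠ 0 → Run p σ t τ → Run (.ite b p q) σ (b.cost σ + 1 + t) τ
  | ite_false {b : Expr} {p q : Cmd} {σ τ : State} {t : ℕ} :
      b.eval σ = 0 → Run q σ t τ → Run (.ite b p q) σ (b.cost σ + 1 + t) τ
  | loop_done {b : Expr} {p : Cmd} {σ : State} :
      b.eval σ = 0 → Run (.loop b p) σ (b.cost σ + 1) σ
  | loop_step {b : Expr} {p : Cmd} {σ ρ τ : State} {t t' : ℕ} :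
      b.eval σ ≠ 0 → Run p σ t ρ → Run (.loop b p) ρ t' τ →
        Run (.loop b p) σ (b.cost σ + 1 + t + t') τ

/-- Machine-readable input with `n` jobs: `W`, `Max`, and the endpoints as fractions. -/
structure Input (n : ℕ) where
  W : ℕ
  Max : ℕ
  sNum : Fin n → ℕ
  sDen : Fin n → ℕ
  eNum : Fin n → ℕ
  eDen : Fin n → ℕ

namespace Input

variable {n : ℕ}

/-- The input describes the instance `I`, whose jobs all have maximum amount `Max`. -/
def Represents (x : Input n) (I : AllocInstance n) (Max : ℕ) : Prop :=
  x.W = I.W ∧ x.Max = Max ∧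
    (∀ i, x.sDen i ≠ 0 ∧ I.s i = (x.sNum i : ℝ) / (x.sDen i : ℝ)) ∧
    ∀ i, x.eDen i ≠ 0 ∧ I.e i = (x.eNum i : ℝ) / (x.eDen i : ℝ)

/-- Length of the input: the binary lengths of all its numbers, with one separator for each. -/
def size (x : Input n) : ℕ :=
  (n.size + 1) + (x.W.size + 1) + (x.Max.size + 1) +
    ∑ i, (((x.sNum i).size + 1) + ((x.sDen i).size + 1) +
      ((x.eNum i).size + 1) + ((x.eDen i).size + 1))

/-- The array that starts with the given entries and is `0` afterwards. -/
def toArr (f : Fin n → ℕ) (j : ℕ) : ℕ := if h : j < n then f ⟨j, h⟩ else 0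

/-- Initial memory: `n`, `W`, `Max` in the variables `0`, `1`, `2`, the endpoints in the arrays
`0` to `3`, and `0` everywhere else. -/
def init (x : Input n) : State where
  var y := match y with
    | 0 => n
    | 1 => x.W
    | 2 => x.Max
    | _ => 0
  arr a := match a with
    | 0 => toArr x.sNum
    | 1 => toArr x.sDen
    | 2 => toArr x.eNum
    | 3 => toArr x.eDen
    | _ => fun _ => 0

end Input

/-- The coloring read off from a final memory: job `i` gets the block that starts with the color in
cell `i` of array `4` and whose length is in cell `i` of array `5`. -/
def output (n : ℕ) (σ : State) (i : Fin n) : Finset ℕ :=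
  Finset.Ico (σ.arr 4 i) (σ.arr 4 i + σ.arr 5 i)

end Ram

/-! Cut the colors into `k = W / Max` blocks of size `Max` and regard each block as a machine. The
best-fit greedy takes the jobs by increasing end time and puts each one on the free machine whose
last job ends latest, rejecting it when no machine is free. It is compared with an arbitrary FBAP
solution `c`, which may split resources freely. At every stage and for every time `τ`, the lead of
the greedy profit over that of `c` is at least `Max` times the number of machines used by processed
jobs ending after `τ`, minus the number of colors that `c` gives to such jobs. This is
`Greedy.ahead`, preserved by `Greedy.step`. Past all end times both counts vanish, so the greedy
solution, although contiguous, beats every FBAP solution.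

The accepted jobs are `k`-colorable, hence no solution earns more than `Max` times the size of a
maximum `k`-colorable set (`MaxColorableSet.sum_card_le`). Conversely a `k`-coloring of such a set
places its jobs on blocks and attains the bound (`ColorableSet.exists_fsapFeasible`).

For part (2) the greedy algorithm is run on the machine. As `W` can be exponential in the input
length, only `min (W / Max) n` machines are kept, which loses nothing. Fractions are compared by
cross-multiplication, stored numbers never outgrow the input length, and each of the `n` rounds
makes two linear scans. The invariant `Holds` ties the memory to `Greedy`. -/

namespace AllocInstance

variable {n : ℕ}

/-! ### Overlapping intervals and busy resources -/

theorem adj_iff (I : AllocInstance n) (i j : Fin n) :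
    I.graph.Adj i j ↔ i ≠ j ∧ I.s i < I.e j ∧ I.s j < I.e i := by
  have hi := I.s_lt_e i
  have hj := I.s_lt_e j
  refine and_congr_right fun _ => ⟨?_, ?_⟩
  · rintro ⟨x, ⟨h1, h2⟩, h3, h4⟩
    exact ⟨by linarith, by linarith⟩
  · rintro ⟨h1, h2⟩
    exact ⟨max (I.s i) (I.s j), ⟨le_max_left _ _, max_lt hi h2⟩, le_max_right _ _, max_lt h1 hj⟩

/-- The resources used by the jobs of `A` that end after time `τ`. -/
noncomputable def busy (I : AllocInstance n) (A : Finset (Fin n)) (c : Fin n → Finset ℕ) (τ : ℝ) :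
    Finset ℕ :=
  (A.filter fun i => τ < I.e i).biUnion c

theorem mem_busy {I : AllocInstance n} {A : Finset (Fin n)} {c : Fin n → Finset ℕ} {τ : ℝ}
    {m : ℕ} : m ∈ I.busy A c τ ↔ ∃ i ∈ A, τ < I.e i ∧ m ∈ c i := by
  simp [busy, and_assoc]

theorem busy_anti (I : AllocInstance n) (A : Finset (Fin n)) (c : Fin n → Finset ℕ) {τ τ' : ℝ}
    (h : τ ≤ τ') : I.busy A c τ' ⊆ I.busy A c τ := by
  intro m hm
  obtain ⟨i, hi, ht, hc⟩ := mem_busy.1 hm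
  exact mem_busy.2 ⟨i, hi, h.trans_lt ht, hc⟩

theorem busy_insert_of_lt (I : AllocInstance n) (A : Finset (Fin n)) (c : Fin n → Finset ℕ)
    {j : Fin n} {τ : ℝ} (h : τ < I.e j) : I.busy (insert j A) c τ = c j ∪ I.busy A c τ := by
  simp [busy, Finset.filter_insert, h]

theorem busy_subset_insert (I : AllocInstance n) (A : Finset (Fin n)) (c : Fin n → Finset ℕ)
    (j : Fin n) (τ : ℝ) : I.busy A c τ ⊆ I.busy (insert j A) c τ := by
  intro m hm
  obtain ⟨i, hi, ht, hc⟩ := mem_busy.1 hm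
  exact mem_busy.2 ⟨i, Finset.mem_insert_of_mem hi, ht, hc⟩

theorem busy_eq_empty {I : AllocInstance n} {A : Finset (Fin n)} {c : Fin n → Finset ℕ} {τ : ℝ}
    (h : ∀ i ∈ A, I.e i ≤ τ) : I.busy A c τ = ∅ := by
  ext m
  simp only [mem_busy, Finset.notMem_empty, iff_false]
  rintro ⟨i, hi, ht, -⟩
  exact absurd (h i hi) (not_le.2 ht)

theorem busy_congr {I : AllocInstance n} {A : Finset (Fin n)} {c c' : Fin n → Finset ℕ}
    (h : ∀ i ∈ A, c i = c' i) (τ : ℝ) : I.busy A c τ = I.busy A c' τ := by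
  refine Finset.biUnion_congr rfl fun i hi => h i (Finset.mem_filter.1 hi).1

/-! ### The best-fit greedy algorithm against an arbitrary solution -/

/-- The state of the best-fit greedy algorithm after the jobs of `A`, which are first in the order
of the end times: `g i` is the machine of job `i`, or empty when `i` is rejected. -/
structure Greedy (I : AllocInstance n) (Max K : ℕ) (A : Finset (Fin n))
    (g : Fin n → Finset ℕ) : Prop where
  supp : ∀ i, i ∉ A → g i = ∅
  sub : ∀ i, g i ⊆ Finset.range K
  card_le : ∀ i, (g i).card ≤ 1
  disj : ∀ i j, I.graph.Adj i j → Disjoint (g i) (g j)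
  sorted : ∀ i ∈ A, ∀ j, j ∉ A → I.e i ≤ I.e j
  -- The potential inequality. `busy` also counts jobs that start after `τ`, which makes it antitone
  -- in `τ`.
  ahead : ∀ c, I.FBAPFeasible c → ∀ τ, ∑ i ∈ A, (c i).card + Max * (I.busy A g τ).card ≤
    Max * ∑ i ∈ A, (g i).card + (I.busy A c τ).card

/-- Some best choice of a machine for job `j`: no machine is free, or `b` is a free machine whose
last job ends latest. -/
def BestFit (I : AllocInstance n) (K : ℕ) (A : Finset (Fin n)) (g : Fin n → Finset ℕ) (j : Fin n)
    (B : Finset ℕ) : Prop :=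
  (B = ∅ ∧ ∀ m < K, m ∈ I.busy A g (I.s j)) ∨
    ∃ b < K, B = {b} ∧ b ∉ I.busy A g (I.s j) ∧
      ∀ m < K, m ∉ I.busy A g (I.s j) → ∀ τ, m ∈ I.busy A g τ → b ∈ I.busy A g τ

variable {I : AllocInstance n} {Max K : ℕ} {A : Finset (Fin n)} {g : Fin n → Finset ℕ} {j : Fin n}

theorem Greedy.empty (I : AllocInstance n) (Max K : ℕ) : I.Greedy Max K ∅ (fun _ => ∅) where
  supp _ _ := rfl
  sub _ := by simp
  card_le _ := by simp
  disj _ _ _ := by simp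
  sorted _ h := by simp at h
  ahead c _ τ := by simp [busy]

/-- A job of `A` that ends after `τ ≥ s j` starts before `e j`, because it ends no later than `j`;
so it overlaps `j`. -/
theorem FBAPFeasible.disjoint_busy {c : Fin n → Finset ℕ} (hc : I.FBAPFeasible c) (hj : j ∉ A)
    (hA : ∀ i ∈ A, I.e i ≤ I.e j) {τ : ℝ} (hτ : I.s j ≤ τ) : Disjoint (c j) (I.busy A c τ) := by
  rw [Finset.disjoint_left]
  intro m hm hb
  obtain ⟨i, hi, ht, hmi⟩ := mem_busy.1 hb
  have hadj : I.graph.Adj j i := (I.adj_iff j i).2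
    ⟨fun h => hj (h ▸ hi), by linarith, (I.s_lt_e i).trans_le (hA i hi)⟩
  exact Finset.disjoint_left.1 (hc.2.2 j i hadj) hm hmi

theorem Greedy.not_adj_of_free (hG : I.Greedy Max K A g) {b : ℕ}
    (hb : b ∉ I.busy A g (I.s j)) (i : Fin n) (hi : b ∈ g i) : ¬ I.graph.Adj i j := by
  intro h
  have h' := (I.adj_iff i j).1 h
  have hiA : i ∈ A := by
    by_contra hn
    simp [hG.supp i hn] at hi
  exact hb (mem_busy.2 ⟨i, hiA, h'.2.2, hi⟩)

/-- Only `ahead` needs an idea. For `s j ≤ τ < e j` the color count of `c` grows by exactly `|c j|`.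
For `τ < s j` the inequality may have to be taken from time `s j`, using that `busy` is antitone.
For `τ ≥ e j` nothing is busy. -/
theorem Greedy.step (hG : I.Greedy Max K A g) (hU : I.IsUniform Max) (hdvd : Max ∣ I.W)
    (hK : K = min (I.W / Max) n) (hj : j ∉ A) (hmin : ∀ i, i ∉ A → I.e j ≤ I.e i)
    {B : Finset ℕ} (hB : I.BestFit K A g j B) :
    I.Greedy Max K (insert j A) (Function.update g j B) := by
  have hA : ∀ i ∈ A, I.e i ≤ I.e j := fun i hi => hG.sorted i hi j hj
  have hgA : ∀ i ∈ A, Function.update g j B i = g i := by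
    intro i hi
    exact Function.update_of_ne (by rintro rfl; exact hj hi) _ _
  have hBK : B ⊆ Finset.range K := by
    rcases hB with ⟨rfl, -⟩ | ⟨b, hb, rfl, -⟩
    · simp
    · simpa using hb
  have hB1 : B.card ≤ 1 := by
    rcases hB with ⟨rfl, -⟩ | ⟨b, hb, rfl, -⟩ <;> simp
  have hfree : ∀ i, I.graph.Adj i j → Disjoint (g i) B := by
    intro i hij
    rcases hB with ⟨rfl, -⟩ | ⟨b, hb, rfl, hb', -⟩
    · simp
    · rw [Finset.disjoint_singleton_right]
      exact fun hi => hG.not_adj_of_free hb' i hi hij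
  have hgsub : ∀ τ, I.busy A g τ ⊆ Finset.range K := by
    intro τ m hm
    obtain ⟨i, -, -, hi⟩ := mem_busy.1 hm
    exact hG.sub i hi
  refine ⟨?_, ?_, ?_, ?_, ?_, ?_⟩
  · intro i hi
    rw [Finset.mem_insert, not_or] at hi
    rw [Function.update_of_ne hi.1, hG.supp i hi.2]
  · intro i
    rcases eq_or_ne i j with rfl | h
    · rwa [Function.update_self]
    · rw [Function.update_of_ne h]; exact hG.sub i
  · intro i
    rcases eq_or_ne i j with rfl | h
    · rwa [Function.update_self]
    · rw [Function.update_of_ne h]; exact hG.card_le i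
  · intro i i' h
    rcases eq_or_ne i j with rfl | hi
    · rw [Function.update_self, Function.update_of_ne h.1.symm]
      exact (hfree i' h.symm).symm
    · rw [Function.update_of_ne hi]
      rcases eq_or_ne i' j with rfl | hi'
      · rw [Function.update_self]
        exact hfree i h
      · rw [Function.update_of_ne hi']
        exact hG.disj i i' h
  · intro i hi k hk
    rw [Finset.mem_insert, not_or] at hk
    rcases Finset.mem_insert.1 hi with rfl | hi
    · exact hmin k hk.2
    · exact hG.sorted i hi k hk.2
  · intro c hc τ
    have hsum : ∑ i ∈ A, (Function.update g j B i).card = ∑ i ∈ A, (g i).card :=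
      Finset.sum_congr rfl fun i hi => by rw [hgA i hi]
    have hbusy : ∀ τ, I.busy A (Function.update g j B) τ = I.busy A g τ := busy_congr hgA
    rw [Finset.sum_insert hj, Finset.sum_insert hj, hsum, Function.update_self]
    have hcM : (c j).card ≤ Max := (hU.2.2.1 j) ▸ hc.2.1 j
    have hs := hG.ahead c hc (I.s j)
    have ht := hG.ahead c hc τ
    have hcup : ∀ τ, I.s j ≤ τ → τ < I.e j → (I.busy (insert j A) c τ).card =
        (c j).card + (I.busy A c τ).card := by
      intro τ h1 h2
      rw [I.busy_insert_of_lt A c h2, Finset.card_union_of_disjoint (hc.disjoint_busy hj hA h1)]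
    have hsup := hcup _ le_rfl (I.s_lt_e j)
    have hmono : (I.busy A c τ).card ≤ (I.busy (insert j A) c τ).card :=
      Finset.card_le_card (I.busy_subset_insert A c j τ)
    have hanti : τ < I.s j → (I.busy (insert j A) c (I.s j)).card ≤
        (I.busy (insert j A) c τ).card := fun h =>
      Finset.card_le_card (I.busy_anti _ _ h.le)
    have hlate : I.e j ≤ τ → ∀ c', I.busy A c' τ = ∅ := fun h c' =>
      busy_eq_empty fun i hi => (hA i hi).trans h
    have hlate' : I.e j ≤ τ → ∀ c', I.busy (insert j A) c' τ = ∅ := fun h c' =>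
      busy_eq_empty fun i hi => by
        rcases Finset.mem_insert.1 hi with rfl | hi
        · exact h
        · exact (hA i hi).trans h
    rcases hB with ⟨rfl, hfull⟩ | ⟨b, hbK, rfl, hb, hbest⟩
    · have hgs : I.busy A g (I.s j) = Finset.range K :=
        (hgsub _).antisymm fun m hm => hfull m (Finset.mem_range.1 hm)
      have hgs' : (I.busy A g (I.s j)).card = K := by rw [hgs, Finset.card_range]
      -- All `K` machines are held by distinct jobs of `A`, and `j` is one more job. Hence the cap
      -- `n` in `K` is not binding, and the machines exhaust all `W` colors.
      have hKA : K ≤ A.card := by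
        calc K = (I.busy A g (I.s j)).card := hgs'.symm
          _ ≤ ∑ i ∈ A.filter (fun i => I.s j < I.e i), (g i).card := Finset.card_biUnion_le
          _ ≤ ∑ i ∈ A.filter (fun i => I.s j < I.e i), 1 :=
            Finset.sum_le_sum fun i _ => hG.card_le i
          _ ≤ A.card := by simpa using Finset.card_filter_le _ _
      have hAn : A.card < n := by
        simpa using Finset.card_lt_univ_of_notMem hj
      have hW : Max * K = I.W := by
        have : K = I.W / Max := by omega
        rw [this, Nat.mul_div_cancel' hdvd]
      have hcW : (I.busy (insert j A) c (I.s j)).card ≤ I.W := by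
        have : I.busy (insert j A) c (I.s j) ⊆ Finset.Icc 1 I.W := by
          intro m hm
          obtain ⟨i, -, -, hi⟩ := mem_busy.1 hm
          exact hc.1 i hi
        simpa using Finset.card_le_card this
      have hb' : I.busy (insert j A) (Function.update g j ∅) τ = I.busy A g τ := by
        rcases lt_or_ge τ (I.e j) with h | h
        · rw [I.busy_insert_of_lt _ _ h, Function.update_self, Finset.empty_union, hbusy]
        · rw [hlate' h, hlate h]
      rw [hb', Finset.card_empty, zero_add]
      rw [hgs', hW] at hs
      rcases lt_or_ge τ (I.s j) with h | h
      · have h1 := hanti h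
        have h2 : (I.busy A g τ).card ≤ K := by simpa using Finset.card_le_card (hgsub τ)
        have h3 := Nat.mul_le_mul_left Max h2
        omega
      · rcases lt_or_ge τ (I.e j) with h' | h'
        · have := hcup τ h h'
          omega
        · rw [hlate h' g, hlate' h' c, Finset.card_empty, mul_zero]
          omega
    · rw [Finset.card_singleton, mul_add, mul_one]
      have hb' : τ < I.e j → I.busy (insert j A) (Function.update g j {b}) τ =
          insert b (I.busy A g τ) := by
        intro h
        rw [I.busy_insert_of_lt _ _ h, Function.update_self, hbusy]
        rfl
      rcases lt_or_ge τ (I.e j) with he | he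
      · rw [hb' he]
        -- If `b` already counts as busy, only the profit changes, and `Max ≥ |c j|`.
        by_cases hbt : b ∈ I.busy A g τ
        · rw [Finset.insert_eq_of_mem hbt]
          omega
        · have hcard : (insert b (I.busy A g τ)).card = (I.busy A g τ).card + 1 :=
            Finset.card_insert_of_notMem hbt
          rw [hcard, mul_add, mul_one]
          rcases lt_or_ge τ (I.s j) with h | h
          -- Best fit enters here: a machine busy at `τ` but free at `s j` would force `b` to be
          -- busy at `τ`. So the inequality at `s j` suffices.
          · have hle : (I.busy A g τ).card ≤ (I.busy A g (I.s j)).card := by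
              refine Finset.card_le_card fun m hm => ?_
              by_contra hn
              exact hbt (hbest m (Finset.mem_range.1 (hgsub τ hm)) hn τ hm)
            have h1 := hanti h
            have h3 := Nat.mul_le_mul_left Max hle
            omega
          · have := hcup τ h he
            omega
      · rw [hlate' he, hlate' he, Finset.card_empty, mul_zero]
        rw [hlate he, hlate he, Finset.card_empty, mul_zero] at ht
        omega

/-! ### From machines to blocks of colors -/

/-- The machine `m` stands for the block of colors `m * Max + 1, …, m * Max + Max`. -/
def blocks (Max : ℕ) (g : Fin n → Finset ℕ) (i : Fin n) : Finset ℕ :=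
  (g i).biUnion fun m => Finset.Ico (m * Max + 1) (m * Max + 1 + Max)

theorem disjoint_block {m m' : ℕ} (h : m ≠ m') :
    Disjoint (Finset.Ico (m * Max + 1) (m * Max + 1 + Max))
      (Finset.Ico (m' * Max + 1) (m' * Max + 1 + Max)) := by
  wlog hlt : m < m' generalizing m m'
  · exact (this h.symm (by omega)).symm
  have : (m + 1) * Max ≤ m' * Max := Nat.mul_le_mul_right _ hlt
  rw [add_mul, one_mul] at this
  rw [Finset.disjoint_left]
  intro x hx hx'
  rw [Finset.mem_Ico] at hx hx'
  omega

theorem blocks_of_card_le (Max : ℕ) {g : Fin n → Finset ℕ} {i : Fin n} (h : (g i).card ≤ 1) :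
    IsBlock (blocks Max g i) ∧ (blocks Max g i).card = Max * (g i).card := by
  rcases Nat.le_one_iff_eq_zero_or_eq_one.1 h with h | h
  · rw [Finset.card_eq_zero] at h
    refine ⟨⟨0, 0, ?_⟩, ?_⟩ <;> simp [blocks, h]
  · obtain ⟨m, hm⟩ := Finset.card_eq_one.1 h
    refine ⟨⟨m * Max + 1, Max, ?_⟩, ?_⟩ <;> simp [blocks, hm]

theorem fsapFeasible_blocks (hU : I.IsUniform Max) (hK : K ≤ I.W / Max)
    (hsub : ∀ i, g i ⊆ Finset.range K) (hcard : ∀ i, (g i).card ≤ 1)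
    (hdisj : ∀ i j, I.graph.Adj i j → Disjoint (g i) (g j)) : I.FSAPFeasible (blocks Max g) := by
  refine ⟨⟨fun i x hx => ?_, fun i => ?_, fun i j hij => ?_⟩,
    fun i => (blocks_of_card_le Max (hcard i)).1⟩
  · simp only [blocks, Finset.mem_biUnion, Finset.mem_Ico] at hx
    obtain ⟨m, hm, h1, h2⟩ := hx
    have hmK : m + 1 ≤ I.W / Max := (Finset.mem_range.1 (hsub i hm)).trans_le hK
    have h3 := (Nat.mul_le_mul_right Max hmK).trans (Nat.div_mul_le_self I.W Max)
    rw [add_mul, one_mul] at h3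
    rw [Finset.mem_Icc]
    omega
  · rw [(blocks_of_card_le Max (hcard i)).2, hU.2.2.1 i]
    exact (Nat.mul_le_mul_left Max (hcard i)).trans_eq (mul_one Max)
  · simp only [blocks, Finset.disjoint_biUnion_left, Finset.disjoint_biUnion_right]
    intro m hm m' hm'
    refine disjoint_block ?_
    rintro rfl
    exact Finset.disjoint_left.1 (hdisj i j hij) hm' hm

theorem IsUniform.profit_eq (hU : I.IsUniform Max) (c : Fin n → Finset ℕ) :
    I.profit c = ((∑ i, (c i).card : ℕ) : ℝ) := by
  simp [profit, hU.2.2.2]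

theorem Greedy.sum_card_le (hG : I.Greedy Max K Finset.univ g) {c : Fin n → Finset ℕ}
    (hc : I.FBAPFeasible c) : ∑ i, (c i).card ≤ Max * ∑ i, (g i).card := by
  obtain ⟨τ, hτ⟩ : ∃ τ, ∀ i, I.e i ≤ τ :=
    -- End times are nonnegative, so their sum bounds each of them.
    ⟨∑ i, I.e i, fun i => Finset.single_le_sum
      (fun i _ => (I.s_nonneg i).trans (I.s_lt_e i).le) (Finset.mem_univ i)⟩
  have h := hG.ahead c hc τ
  rw [busy_eq_empty fun i _ => hτ i, busy_eq_empty fun i _ => hτ i] at h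
  simpa using h

theorem Greedy.fsapOptimal (hG : I.Greedy Max K Finset.univ g) (hU : I.IsUniform Max)
    (hK : K = min (I.W / Max) n) : I.FSAPOptimal (blocks Max g) := by
  refine ⟨fsapFeasible_blocks hU (hK.trans_le (min_le_left _ _)) hG.sub hG.card_le hG.disj,
    fun c hc => ?_⟩
  rw [hU.profit_eq, hU.profit_eq, Nat.cast_le]
  refine (hG.sum_card_le hc.1).trans_eq ?_
  rw [Finset.mul_sum]
  exact Finset.sum_congr rfl fun i _ => ((blocks_of_card_le Max (hG.card_le i)).2).symm

/-! ### Existence of a greedy solution and maximum colorable sets -/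

theorem exists_bestFit (I : AllocInstance n) (K : ℕ) (A : Finset (Fin n)) (g : Fin n → Finset ℕ)
    (j : Fin n) : ∃ B, I.BestFit K A g j B := by
  by_cases hfull : ∀ m < K, m ∈ I.busy A g (I.s j)
  · exact ⟨∅, Or.inl ⟨rfl, hfull⟩⟩
  push Not at hfull
  obtain ⟨m₀, hm₀, hm₀'⟩ := hfull
  obtain ⟨b, hb, hbest⟩ := Finset.exists_max_image
    ((Finset.range K).filter fun m => m ∉ I.busy A g (I.s j))
    -- The latest end time on `m`, with `⊥` for a machine that has no job yet.
    (fun m => (A.filter fun i => m ∈ g i).sup fun i => ((I.e i : ℝ) : WithBot ℝ))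
    ⟨m₀, by simp [hm₀, hm₀']⟩
  rw [Finset.mem_filter, Finset.mem_range] at hb
  refine ⟨{b}, Or.inr ⟨b, hb.1, rfl, hb.2, fun m hm hmf τ hmτ => ?_⟩⟩
  have hle := hbest m (by simp [hm, hmf])
  obtain ⟨i, hi, hiτ, hmi⟩ := mem_busy.1 hmτ
  have h1 : ((τ : ℝ) : WithBot ℝ) < (A.filter fun i => b ∈ g i).sup
      fun i => ((I.e i : ℝ) : WithBot ℝ) :=
    (WithBot.coe_lt_coe.2 hiτ).trans_le
      ((Finset.le_sup (f := fun i => ((I.e i : ℝ) : WithBot ℝ)) (by simp [hi, hmi])).trans hle)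
  obtain ⟨k, hk, hkτ⟩ := Finset.lt_sup_iff.1 h1
  rw [Finset.mem_filter] at hk
  exact mem_busy.2 ⟨k, hk.1, WithBot.coe_lt_coe.1 hkτ, hk.2⟩

theorem exists_greedy (hU : I.IsUniform Max) (hdvd : Max ∣ I.W) :
    ∃ g, I.Greedy Max (min (I.W / Max) n) Finset.univ g := by
  have key : ∀ t ≤ n, ∃ A g, A.card = t ∧ I.Greedy Max (min (I.W / Max) n) A g := by
    intro t
    induction t with
    | zero => exact fun _ => ⟨∅, _, rfl, Greedy.empty I Max _⟩
    | succ t ih =>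
      intro ht
      obtain ⟨A, g, hA, hG⟩ := ih (by omega)
      have hne : (Finset.univ \ A).Nonempty := by
        rw [← Finset.card_pos, Finset.card_sdiff_of_subset (Finset.subset_univ _)]
        simp only [Finset.card_univ, Fintype.card_fin]
        omega
      obtain ⟨j, hj, hmin⟩ := Finset.exists_min_image _ I.e hne
      obtain ⟨B, hB⟩ := I.exists_bestFit (min (I.W / Max) n) A g j
      have hj' : j ∉ A := by simpa using hj
      exact ⟨insert j A, _, by rw [Finset.card_insert_of_notMem hj', hA],
        hG.step hU hdvd rfl hj' (fun i hi => hmin i (by simpa using hi)) hB⟩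
  obtain ⟨A, g, hA, hG⟩ := key n le_rfl
  have : A = Finset.univ := Finset.eq_univ_of_card A (by simpa using hA)
  exact ⟨g, this ▸ hG⟩

/-- The machine of an accepted job is a proper coloring with at most `W / Max` colors, so the greedy
algorithm accepts at most `S.card` jobs. -/
theorem MaxColorableSet.sum_card_le {S : Finset (Fin n)} (hS : I.MaxColorableSet (I.W / Max) S)
    (hU : I.IsUniform Max) (hdvd : Max ∣ I.W) {c : Fin n → Finset ℕ} (hc : I.FBAPFeasible c) :
    ∑ i, (c i).card ≤ Max * S.card := by
  obtain ⟨g, hG⟩ := exists_greedy hU hdvd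
  refine (hG.sum_card_le hc).trans (Nat.mul_le_mul_left _ ?_)
  have hcol : I.ColorableSet (I.W / Max) (Finset.univ.filter fun i => g i ≠ ∅) := by
    have hne : ∀ i : ((Finset.univ.filter fun i => g i ≠ ∅ : Finset (Fin n)) : Set (Fin n)),
        (g i).Nonempty := fun i => Finset.nonempty_iff_ne_empty.2 (by simpa using i.2)
    have hlt : ∀ i (h : (g i).Nonempty), (g i).min' h < I.W / Max := fun i h =>
      (Finset.mem_range.1 (hG.sub i (Finset.min'_mem _ h))).trans_le (min_le_left _ _)
    refine ⟨SimpleGraph.Coloring.mk (fun i => ⟨(g i).min' (hne i), hlt _ (hne i)⟩) ?_⟩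
    intro i j hij heq
    have h1 := Finset.disjoint_left.1 (hG.disj i j hij) (Finset.min'_mem _ (hne i))
    rw [Fin.mk.injEq] at heq
    exact h1 (heq ▸ Finset.min'_mem _ (hne j))
  refine le_trans ?_ (hS.2 _ hcol)
  rw [Finset.card_filter]
  refine Finset.sum_le_sum fun i _ => ?_
  split_ifs with h
  · exact hG.card_le i
  · simp [not_not.1 h]

theorem ColorableSet.exists_fsapFeasible {S : Finset (Fin n)} (hS : I.ColorableSet (I.W / Max) S)
    (hU : I.IsUniform Max) :
    ∃ c, I.FSAPFeasible c ∧ ∀ i, (c i).card = if i ∈ S then Max else 0 := by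
  obtain ⟨C⟩ := hS
  let g : Fin n → Finset ℕ := fun i => if h : i ∈ S then {(C ⟨i, h⟩ : ℕ)} else ∅
  have hcard : ∀ i, (g i).card = if i ∈ S then 1 else 0 := by
    intro i
    by_cases h : i ∈ S <;> simp [g, h]
  have hcard1 : ∀ i, (g i).card ≤ 1 := fun i => by rw [hcard]; split_ifs <;> simp
  refine ⟨blocks Max g, fsapFeasible_blocks hU le_rfl ?_ hcard1 ?_, fun i => ?_⟩
  · intro i
    by_cases h : i ∈ S <;> simp [g, h]
  · intro i j hij
    by_cases hi : i ∈ S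
    · by_cases hj : j ∈ S
      · simp only [g, hi, hj, dif_pos, Finset.disjoint_singleton]
        intro heq
        exact C.valid (v := ⟨i, hi⟩) (w := ⟨j, hj⟩) hij (Fin.ext heq)
      · simp [g, hj]
    · simp [g, hi]
  · rw [(blocks_of_card_le Max (hcard1 i)).2, hcard]
    split_ifs <;> simp

theorem MaxColorableSet.optimal {S : Finset (Fin n)} (hS : I.MaxColorableSet (I.W / Max) S)
    (hU : I.IsUniform Max) (hdvd : Max ∣ I.W) {c : Fin n → Finset ℕ} (hc : I.FSAPFeasible c)
    (hcard : ∀ i, (c i).card = if i ∈ S then Max else 0) :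
    I.FSAPOptimal c ∧ I.FBAPOptimal c := by
  have hle : ∀ c', I.FBAPFeasible c' → I.profit c' ≤ I.profit c := by
    intro c' hc'
    rw [hU.profit_eq, hU.profit_eq, Nat.cast_le]
    refine (hS.sum_card_le hU hdvd hc').trans_eq ?_
    simp [hcard, mul_comm]
  exact ⟨⟨hc, fun c' hc' => hle c' hc'.1⟩, hc.1, hle⟩

theorem exists_maxColorableSet (I : AllocInstance n) (k : ℕ) : ∃ S, I.MaxColorableSet k S := by
  classical
  obtain ⟨S, hS, hmax⟩ := Finset.exists_max_image
    (Finset.univ.filter fun S => I.ColorableSet k S) Finset.card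
    ⟨∅, by
      have : IsEmpty ((∅ : Finset (Fin n)) : Set (Fin n)) := by simp
      have h : I.ColorableSet k ∅ := SimpleGraph.Colorable.of_isEmpty k
      simpa using h⟩
  exact ⟨S, by simpa using hS, fun T hT => hmax T (by simpa using hT)⟩

end AllocInstance

namespace Ram

/-! ### Bit lengths, costs and rules for running programs -/

/-- The number of nodes of an expression, and of bits of its constants. -/
def Expr.weight : Expr → ℕ
  | .const c => 1 + c.size
  | .var _ => 1
  | .get _ i => i.weight + 1
  | .add u v => u.weight + v.weight + 1
  | .sub u v => u.weight + v.weight + 1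
  | .mul u v => u.weight + v.weight + 1
  | .div u v => u.weight + v.weight + 1
  | .lt u v => u.weight + v.weight + 1

/-- All numbers in memory have at most `L` bits. -/
def Fits (L : ℕ) (σ : State) : Prop :=
  (∀ x, (σ.var x).size ≤ L) ∧ ∀ a i, (σ.arr a i).size ≤ L

theorem size_add_le (a b : ℕ) : (a + b).size ≤ a.size + b.size + 1 := by
  rw [Nat.size_le]
  have ha := Nat.lt_size_self a
  have hb := Nat.lt_size_self b
  have h1 : 2 ^ a.size ≤ 2 ^ (a.size + b.size) := Nat.pow_le_pow_right two_pos (by omega)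
  have h2 : 2 ^ b.size ≤ 2 ^ (a.size + b.size) := Nat.pow_le_pow_right two_pos (by omega)
  rw [pow_succ]
  omega

theorem size_mul_le (a b : ℕ) : (a * b).size ≤ a.size + b.size := by
  rw [Nat.size_le, pow_add]
  exact Nat.mul_lt_mul'' (Nat.lt_size_self a) (Nat.lt_size_self b)

theorem Fits.size_eval_le {L : ℕ} {σ : State} (h : Fits L σ) (u : Expr) :
    (u.eval σ).size ≤ u.weight * (L + 1) := by
  induction u with
  | const c => simp only [Expr.eval, Expr.weight]; nlinarith
  | var x => have := h.1 x; simp only [Expr.eval, Expr.weight]; omega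
  | get a i ih => have := h.2 a (i.eval σ); simp only [Expr.eval, Expr.weight]; nlinarith
  | add u v hu hv =>
    have := size_add_le (u.eval σ) (v.eval σ); simp only [Expr.eval, Expr.weight]; nlinarith
  | sub u v hu hv =>
    have : (u.eval σ - v.eval σ).size ≤ (u.eval σ).size := Nat.size_le_size (Nat.sub_le _ _)
    simp only [Expr.eval, Expr.weight]; nlinarith
  | mul u v hu hv =>
    have := size_mul_le (u.eval σ) (v.eval σ); simp only [Expr.eval, Expr.weight]; nlinarith
  | div u v hu hv =>
    have : (u.eval σ / v.eval σ).size ≤ (u.eval σ).size := Nat.size_le_size (Nat.div_le_self _ _)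
    simp only [Expr.eval, Expr.weight]; nlinarith
  | lt u v hu hv =>
    have : (if u.eval σ < v.eval σ then 1 else 0).size ≤ 1 := by split_ifs <;> simp
    simp only [Expr.eval, Expr.weight]; nlinarith

/-- Each node costs at most its share of the weight times a bound on all intermediate values. `N` is
kept apart from `u.weight` so that this bound stays fixed in the induction. -/
theorem Fits.cost_le {L : ℕ} {σ : State} (h : Fits L σ) (N : ℕ) (u : Expr) (hN : u.weight ≤ N) :
    u.cost σ ≤ u.weight * (N * (L + 1) + 2) := by
  have key : ∀ u : Expr, u.weight ≤ N → (u.eval σ).size ≤ N * (L + 1) := fun u hu =>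
    (h.size_eval_le u).trans (Nat.mul_le_mul_right _ hu)
  have hev := key u hN
  induction u with
  | const c => simp only [Expr.eval, Expr.weight, Expr.cost] at *; nlinarith
  | var x => simp only [Expr.eval, Expr.weight, Expr.cost] at *; omega
  | get a i ih =>
    simp only [Expr.weight] at hN
    have := ih (by omega) (key i (by omega))
    simp only [Expr.eval, Expr.weight, Expr.cost] at *; nlinarith
  | add u v hu hv | sub u v hu hv | mul u v hu hv | div u v hu hv | lt u v hu hv =>
    simp only [Expr.weight] at hN
    have := hu (by omega) (key u (by omega))
    have := hv (by omega) (key v (by omega))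
    simp only [Expr.eval, Expr.weight, Expr.cost] at *; nlinarith

/-- A bound for the cost of the evaluation of any expression of weight at most `60`. -/
def unitCost (L : ℕ) : ℕ := 4000 * (L + 1)

theorem Fits.cost_lt {L : ℕ} {σ : State} (h : Fits L σ) {u : Expr} (hu : u.weight ≤ 60) :
    u.cost σ + 1 ≤ unitCost L := by
  have h1 := h.cost_le 60 u hu
  have h2 := Nat.mul_le_mul_right (60 * (L + 1) + 2) hu
  -- `60 * (60 * (L + 1) + 2) + 1 ≤ 4000 * (L + 1)`.
  unfold unitCost
  omega

theorem Fits.setVar {L : ℕ} {σ : State} (h : Fits L σ) (x : ℕ) {v : ℕ} (hv : v.size ≤ L) :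
    Fits L (σ.setVar x v) := by
  refine ⟨fun y => ?_, h.2⟩
  simp only [State.setVar, Function.update_apply]
  split_ifs
  exacts [hv, h.1 y]

theorem Fits.setArr {L : ℕ} {σ : State} (h : Fits L σ) (a i : ℕ) {v : ℕ} (hv : v.size ≤ L) :
    Fits L (σ.setArr a i v) := by
  refine ⟨h.1, fun b k => ?_⟩
  simp only [State.setArr, Function.update_apply]
  split_ifs with h1
  · simp only [Function.update_apply]
    split_ifs
    exacts [hv, h.2 a k]
  · exact h.2 b k

/-- Started in `σ`, the program `p` halts at cost at most `T` in a state that satisfies `Q`. -/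
def Ends (p : Cmd) (σ : State) (T : ℕ) (Q : State → Prop) : Prop :=
  ∃ t τ, Run p σ t τ ∧ t ≤ T ∧ Q τ

theorem Ends.mono {p : Cmd} {σ : State} {T T' : ℕ} {Q Q' : State → Prop} (h : Ends p σ T Q)
    (hT : T ≤ T') (hQ : ∀ τ, Q τ → Q' τ) : Ends p σ T' Q' := by
  obtain ⟨t, τ, h1, h2, h3⟩ := h
  exact ⟨t, τ, h1, h2.trans hT, hQ τ h3⟩

theorem Ends.skip {σ : State} {L : ℕ} {Q : State → Prop} (hQ : Q σ) :
    Ends .skip σ (unitCost L) Q :=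
  ⟨1, σ, .skip σ, by unfold unitCost; omega, hQ⟩

theorem Ends.assign {σ : State} {L x : ℕ} {u : Expr} {Q : State → Prop} (hL : Fits L σ)
    (hu : u.weight ≤ 60) (hQ : Q (σ.setVar x (u.eval σ))) :
    Ends (.assign x u) σ (unitCost L) Q :=
  ⟨_, _, .assign x u σ, hL.cost_lt hu, hQ⟩

theorem Ends.store {σ : State} {L a : ℕ} {i u : Expr} {Q : State → Prop} (hL : Fits L σ)
    (hi : i.weight ≤ 60) (hu : u.weight ≤ 60) (hQ : Q (σ.setArr a (i.eval σ) (u.eval σ))) :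
    Ends (.store a i u) σ (2 * unitCost L) Q := by
  refine ⟨_, _, .store a i u σ, ?_, hQ⟩
  have := hL.cost_lt hi
  have := hL.cost_lt hu
  omega

theorem Ends.seq {p q : Cmd} {σ : State} {T T' : ℕ} {Q : State → Prop}
    (h : Ends p σ T fun ρ => Ends q ρ T' Q) : Ends (.seq p q) σ (T + T') Q := by
  obtain ⟨t, ρ, h1, h2, t', τ, h3, h4, h5⟩ := h
  exact ⟨_, τ, .seq h1 h3, by omega, h5⟩

theorem Ends.ite {b : Expr} {p q : Cmd} {σ : State} {L T : ℕ} {Q : State → Prop} (hL : Fits L σ)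
    (hb : b.weight ≤ 60) (hp : b.eval σ ≠ 0 → Ends p σ T Q) (hq : b.eval σ = 0 → Ends q σ T Q) :
    Ends (.ite b p q) σ (unitCost L + T) Q := by
  have hc := hL.cost_lt hb
  by_cases h : b.eval σ = 0
  · obtain ⟨t, τ, h1, h2, h3⟩ := hq h
    exact ⟨_, τ, .ite_false h h1, by omega, h3⟩
  · obtain ⟨t, τ, h1, h2, h3⟩ := hp h
    exact ⟨_, τ, .ite_true h h1, by omega, h3⟩

/-- A loop whose guard tests whether a counter is below `N`. -/
theorem Ends.loop {b : Expr} {p : Cmd} {L T N : ℕ} (Inv : ℕ → State → Prop)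
    (hL : ∀ k σ, Inv k σ → Fits L σ) (hb : b.weight ≤ 60)
    (hguard : ∀ k σ, Inv k σ → (b.eval σ ≠ 0 ↔ k < N))
    (hstep : ∀ k σ, k < N → Inv k σ → Ends p σ T (Inv (k + 1))) {σ : State} (hσ : Inv 0 σ) :
    Ends (.loop b p) σ (N * (T + unitCost L) + unitCost L) (Inv N) := by
  have key : ∀ r k σ, k + r = N → Inv k σ →
      Ends (.loop b p) σ (r * (T + unitCost L) + unitCost L) (Inv N) := by
    intro r
    induction r with
    | zero =>
      intro k σ hk hI
      have hc := (hL k σ hI).cost_lt hb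
      have h0 : b.eval σ = 0 := by
        by_contra h
        have := (hguard k σ hI).1 h
        omega
      obtain rfl : k = N := by omega
      exact ⟨_, σ, .loop_done h0, by omega, hI⟩
    | succ r ih =>
      intro k σ hk hI
      have hc := (hL k σ hI).cost_lt hb
      obtain ⟨t, ρ, h1, h2, h3⟩ := hstep k σ (by omega) hI
      obtain ⟨t', τ, h4, h5, h6⟩ := ih (k + 1) ρ (by omega) h3
      refine ⟨_, τ, .loop_step ((hguard k σ hI).2 (by omega)) h1 h4, ?_, h6⟩
      rw [add_mul]
      omega
  exact key N 0 σ (zero_add N) hσ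

/-! ### The program -/

theorem div_lt_div_iff_nat (a c : ℕ) {b d : ℕ} (hb : b ≠ 0) (hd : d ≠ 0) :
    (a : ℝ) / (b : ℝ) < (c : ℝ) / (d : ℝ) ↔ a * d < c * b := by
  rw [div_lt_div_iff₀ (by positivity) (by positivity)]
  exact_mod_cast Iff.rfl

/-! The program keeps the number of machines in variable `3` and the number of processed jobs in
variable `4`. It marks the processed jobs in array `6`; the last job on machine `m` ends at the
fraction with numerator in cell `m` of array `7` and denominator one more than cell `m` of
array `8`. -/

/-- Lower variable `6` to job number `var 5` when that one is unprocessed and ends earlier. -/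
def selectStep : Cmd :=
  .seq
    (.ite
      -- In guards a product is a conjunction, a sum a disjunction, and `1 - u` a negation. The
      -- value `n` of variable `6` means that no job is chosen yet; in `fitStep`, `K` plays this
      -- role for variable `7`.
      (.mul (.sub (.const 1) (.get 6 (.var 5)))
        (.add (.sub (.const 1) (.lt (.var 6) (.var 0)))
          (.lt (.mul (.get 2 (.var 5)) (.get 3 (.var 6)))
            (.mul (.get 2 (.var 6)) (.get 3 (.var 5))))))
      (.assign 6 (.var 5)) .skip)
    (.assign 5 (.add (.var 5) (.const 1)))

/-- Change variable `7` to machine number `var 5` when that one is free for job `var 6` and a better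
fit. -/
def fitStep : Cmd :=
  .seq
    (.ite
      (.mul
        (.sub (.const 1)
          (.lt (.mul (.get 0 (.var 6)) (.add (.get 8 (.var 5)) (.const 1)))
            (.mul (.get 7 (.var 5)) (.get 1 (.var 6)))))
        (.add (.sub (.const 1) (.lt (.var 7) (.var 3)))
          (.lt (.mul (.get 7 (.var 7)) (.add (.get 8 (.var 5)) (.const 1)))
            (.mul (.get 7 (.var 5)) (.add (.get 8 (.var 7)) (.const 1))))))
      (.assign 7 (.var 5)) .skip)
    (.assign 5 (.add (.var 5) (.const 1)))

/-- Put job `var 6` on machine `var 7`. -/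
def place : Cmd :=
  .seq (.store 7 (.var 7) (.get 2 (.var 6)))
    (.seq (.store 8 (.var 7) (.sub (.get 3 (.var 6)) (.const 1)))
      (.seq (.store 4 (.var 6) (.add (.mul (.var 7) (.var 2)) (.const 1)))
        (.store 5 (.var 6) (.var 2))))

/-- Process the next job in the order of the end times. -/
def processJob : Cmd :=
  .seq (.assign 5 (.const 0)) <| .seq (.assign 6 (.var 0)) <|
  .seq (.loop (.lt (.var 5) (.var 0)) selectStep) <|
  .seq (.assign 5 (.const 0)) <| .seq (.assign 7 (.var 3)) <|
  .seq (.loop (.lt (.var 5) (.var 3)) fitStep) <|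
  .seq (.ite (.lt (.var 7) (.var 3)) place .skip) <|
  .seq (.store 6 (.var 6) (.const 1)) (.assign 4 (.add (.var 4) (.const 1)))

/-- The best-fit greedy algorithm. -/
def greedyProgram : Cmd :=
  .seq (.assign 3 (.div (.var 1) (.var 2))) <|
  .seq (.ite (.lt (.var 0) (.var 3)) (.assign 3 (.var 0)) .skip)
    (.loop (.lt (.var 4) (.var 0)) processJob)

/-- End time of the last job on machine `m`. -/
noncomputable def State.last (σ : State) (m : ℕ) : ℝ :=
  (σ.arr 7 m : ℝ) / ((σ.arr 8 m + 1 : ℕ) : ℝ)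

/-! ### Correctness and running time of the program -/

open AllocInstance

variable {n : ℕ}

/-- The memory between the phases of the program, when the greedy algorithm has processed the jobs
of `A` with result `g`. -/
structure Holds (I : AllocInstance n) (Max K L : ℕ) (x : Input n) (A : Finset (Fin n))
    (g : Fin n → Finset ℕ) (σ : State) : Prop where
  fits : Fits L σ
  v0 : σ.var 0 = n
  v2 : σ.var 2 = Max
  v3 : σ.var 3 = K
  v4 : σ.var 4 = A.card
  a0 : σ.arr 0 = Input.toArr x.sNum
  a1 : σ.arr 1 = Input.toArr x.sDen
  a2 : σ.arr 2 = Input.toArr x.eNum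
  a3 : σ.arr 3 = Input.toArr x.eDen
  marks : ∀ i : Fin n, σ.arr 6 i = if i ∈ A then 1 else 0
  last : ∀ m < K, ∀ τ : ℝ, 0 ≤ τ → (m ∈ I.busy A g τ ↔ τ < σ.last m)
  out : ∀ i, output n σ i = blocks Max g i
  greedy : I.Greedy Max K A g

theorem toArr_coe (f : Fin n → ℕ) (i : Fin n) : Input.toArr f i = f i := by
  simp [Input.toArr]

variable {I : AllocInstance n} {Max K L : ℕ} {x : Input n} {A : Finset (Fin n)}
  {g : Fin n → Finset ℕ} {σ : State} {j : Fin n}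

/-- Variables from `5` on are scratch space, which the invariant does not mention. -/
theorem Holds.setVar (h : Holds I Max K L x A g σ) {y v : ℕ} (hy : 5 ≤ y) (hv : v.size ≤ L) :
    Holds I Max K L x A g (σ.setVar y v) := by
  have hvar : ∀ z < 5, (σ.setVar y v).var z = σ.var z := fun z hz =>
    Function.update_of_ne (by omega) _ _
  exact ⟨h.fits.setVar y hv, (hvar 0 (by omega)).trans h.v0, (hvar 2 (by omega)).trans h.v2,
    (hvar 3 (by omega)).trans h.v3, (hvar 4 (by omega)).trans h.v4, h.a0, h.a1, h.a2, h.a3,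
    h.marks, h.last, h.out, h.greedy⟩

theorem Holds.size_le (h : Holds I Max K L x A g σ) {v : ℕ} (hv : v ≤ n) : v.size ≤ L :=
  (Nat.size_le_size hv).trans (h.v0 ▸ h.fits.1 0)

theorem setVar_var_self (σ : State) (y v : ℕ) : (σ.setVar y v).var y = v :=
  Function.update_self ..

theorem setVar_var_of_ne (σ : State) {y z : ℕ} (v : ℕ) (h : z ≠ y) :
    (σ.setVar y v).var z = σ.var z :=
  Function.update_of_ne h ..

theorem lt_end_iff (hx : x.Represents I Max) (i k : Fin n) :
    I.e i < I.e k ↔ x.eNum i * x.eDen k < x.eNum k * x.eDen i := by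
  rw [(hx.2.2.2 i).2, (hx.2.2.2 k).2]
  exact div_lt_div_iff_nat _ _ (hx.2.2.2 i).1 (hx.2.2.2 k).1

/-- After the comparison with the first `k` jobs. -/
def Selecting (I : AllocInstance n) (Max K L : ℕ) (x : Input n) (A : Finset (Fin n))
    (g : Fin n → Finset ℕ) (k : ℕ) (σ : State) : Prop :=
  Holds I Max K L x A g σ ∧ σ.var 5 = k ∧
    ((σ.var 6 = n ∧ ∀ i : Fin n, (i : ℕ) < k → i ∈ A) ∨
      ∃ j : Fin n, σ.var 6 = j ∧ j ∉ A ∧ ∀ i : Fin n, (i : ℕ) < k → i ∉ A → I.e j ≤ I.e i)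

theorem selectStep_ends (hx : x.Represents I Max) {k : ℕ} (hk : k < n)
    (h : Selecting I Max K L x A g k σ) :
    Ends selectStep σ (3 * unitCost L) (Selecting I Max K L x A g (k + 1)) := by
  obtain ⟨hH, h5, hsel⟩ := h
  have hmark := hH.marks ⟨k, hk⟩
  have hb2 := toArr_coe x.eNum ⟨k, hk⟩
  have hb3 := toArr_coe x.eDen ⟨k, hk⟩
  simp only at hmark hb2 hb3
  have hfin : ∀ σ' : State, Holds I Max K L x A g σ' → σ'.var 5 = k →
      ((σ'.var 6 = n ∧ ∀ i : Fin n, (i : ℕ) < k + 1 → i ∈ A) ∨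
      ∃ j : Fin n, σ'.var 6 = j ∧ j ∉ A ∧
        ∀ i : Fin n, (i : ℕ) < k + 1 → i ∉ A → I.e j ≤ I.e i) →
      Ends (.assign 5 (.add (.var 5) (.const 1))) σ' (unitCost L)
        (Selecting I Max K L x A g (k + 1)) := by
    intro σ' h' h5' hs
    refine Ends.assign h'.fits (by decide) ⟨h'.setVar le_rfl ?_, ?_, ?_⟩
    · simpa [Expr.eval, h5'] using h'.size_le hk
    · rw [setVar_var_self]; simp [Expr.eval, h5']
    · rwa [setVar_var_of_ne _ _ (by decide)]
  have hsucc : ∀ i : Fin n, (i : ℕ) < k + 1 → (i : ℕ) < k ∨ i = ⟨k, hk⟩ := by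
    intro i hi
    rcases Nat.lt_succ_iff_lt_or_eq.1 hi with h | h
    · exact Or.inl h
    · exact Or.inr (Fin.ext h)
  refine Ends.mono (T := unitCost L + unitCost L + unitCost L) ?_ (by omega) fun _ h => h
  refine Ends.seq (Ends.ite hH.fits (by decide) (fun hb => ?_) fun hb => ?_)
  · refine Ends.assign hH.fits (by decide) (hfin _ (hH.setVar (by omega) ?_) ?_ (Or.inr ?_))
    · exact hH.fits.1 5
    · rwa [setVar_var_of_ne _ _ (by decide)]
    · refine ⟨⟨k, hk⟩, by rw [setVar_var_self]; simpa [Expr.eval] using h5, ?_⟩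
      have hkA : (⟨k, hk⟩ : Fin n) ∉ A := by
        intro hA
        simp [Expr.eval, h5, hmark, hA] at hb
      refine ⟨hkA, fun i hi hiA => ?_⟩
      rcases hsucc i hi with hi | rfl
      · rcases hsel with ⟨-, hall⟩ | ⟨j, h6, -, hmin⟩
        · exact absurd (hall i hi) hiA
        · have hlt : I.e ⟨k, hk⟩ < I.e j := by
            rw [lt_end_iff hx]
            by_contra hn
            simp [Expr.eval, h5, h6, hH.v0, hH.a2, hH.a3, toArr_coe, hb2, hb3, hn] at hb
          exact hlt.le.trans (hmin i hi hiA)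
      · exact le_rfl
  · refine Ends.skip (hfin σ hH h5 ?_)
    by_cases hkA : (⟨k, hk⟩ : Fin n) ∈ A
    · refine hsel.imp (fun h => ⟨h.1, fun i hi => ?_⟩) ?_
      · rcases hsucc i hi with hi | rfl
        exacts [h.2 i hi, hkA]
      · rintro ⟨j, h6, hj, hmin⟩
        refine ⟨j, h6, hj, fun i hi hiA => ?_⟩
        rcases hsucc i hi with hi | rfl
        exacts [hmin i hi hiA, absurd hkA hiA]
    · rcases hsel with ⟨h6, -⟩ | ⟨j, h6, hj, hmin⟩
      · simp [Expr.eval, h5, h6, hH.v0, hmark, hkA] at hb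
      · refine Or.inr ⟨j, h6, hj, fun i hi hiA => ?_⟩
        rcases hsucc i hi with hi | rfl
        · exact hmin i hi hiA
        · rw [← not_lt, lt_end_iff hx]
          intro hlt
          simp [Expr.eval, h5, h6, hH.v0, hmark, hkA, hH.a2, hH.a3, toArr_coe, hb2, hb3, hlt] at hb

/-- After the comparison with the first `k` machines. -/
def Fitting (I : AllocInstance n) (Max K L : ℕ) (x : Input n) (A : Finset (Fin n))
    (g : Fin n → Finset ℕ) (j : Fin n) (k : ℕ) (σ : State) : Prop :=
  Holds I Max K L x A g σ ∧ σ.var 5 = k ∧ σ.var 6 = j ∧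
    ((σ.var 7 = K ∧ ∀ m < k, I.s j < σ.last m) ∨
      (σ.var 7 < K ∧ σ.last (σ.var 7) ≤ I.s j ∧
        ∀ m < k, σ.last m ≤ I.s j → σ.last m ≤ σ.last (σ.var 7)))

theorem fitStep_ends (hx : x.Represents I Max) (hKn : K ≤ n) {k : ℕ} (hk : k < K)
    (h : Fitting I Max K L x A g j k σ) :
    Ends fitStep σ (3 * unitCost L) (Fitting I Max K L x A g j (k + 1)) := by
  obtain ⟨hH, h5, h6, hfit⟩ := h
  have hfin : ∀ σ' : State, Holds I Max K L x A g σ' → σ'.var 5 = k → σ'.var 6 = j →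
      ((σ'.var 7 = K ∧ ∀ m < k + 1, I.s j < σ'.last m) ∨
      (σ'.var 7 < K ∧ σ'.last (σ'.var 7) ≤ I.s j ∧
        ∀ m < k + 1, σ'.last m ≤ I.s j → σ'.last m ≤ σ'.last (σ'.var 7))) →
      Ends (.assign 5 (.add (.var 5) (.const 1))) σ' (unitCost L)
        (Fitting I Max K L x A g j (k + 1)) := by
    intro σ' h' h5' h6' hs
    refine Ends.assign h'.fits (by decide) ⟨h'.setVar le_rfl ?_, ?_, ?_, ?_⟩
    · simpa [Expr.eval, h5'] using h'.size_le (hk.trans_le hKn)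
    · rw [setVar_var_self]; simp [Expr.eval, h5']
    · rwa [setVar_var_of_ne _ _ (by decide)]
    · rwa [setVar_var_of_ne _ _ (by decide)]
  have hfree : I.s j < σ.last k ↔ x.sNum j * (σ.arr 8 k + 1) < σ.arr 7 k * x.sDen j := by
    rw [(hx.2.2.1 j).2, State.last]
    exact div_lt_div_iff_nat _ _ (hx.2.2.1 j).1 (Nat.succ_ne_zero _)
  have hbetter : ∀ b, σ.last b < σ.last k ↔
      σ.arr 7 b * (σ.arr 8 k + 1) < σ.arr 7 k * (σ.arr 8 b + 1) := fun b =>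
    div_lt_div_iff_nat _ _ (Nat.succ_ne_zero _) (Nat.succ_ne_zero _)
  refine Ends.mono (T := unitCost L + unitCost L + unitCost L) ?_ (by omega) fun _ h => h
  refine Ends.seq (Ends.ite hH.fits (by decide) (fun hb => ?_) fun hb => ?_)
  · have hkf : σ.last k ≤ I.s j := by
      rw [← not_lt, hfree]
      intro hlt
      simp [Expr.eval, h5, h6, hH.a0, hH.a1, toArr_coe, hlt] at hb
    refine Ends.assign hH.fits (by decide)
      (hfin _ (hH.setVar (by omega) (hH.fits.1 5)) ?_ ?_ (Or.inr ?_))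
    · rwa [setVar_var_of_ne _ _ (by decide)]
    · rwa [setVar_var_of_ne _ _ (by decide)]
    · rw [setVar_var_self]
      change σ.var 5 < K ∧ σ.last (σ.var 5) ≤ I.s j ∧
        ∀ m < k + 1, σ.last m ≤ I.s j → σ.last m ≤ σ.last (σ.var 5)
      rw [h5]
      refine ⟨hk, hkf, fun m hm hmf => ?_⟩
      rcases Nat.lt_succ_iff_lt_or_eq.1 hm with hm | rfl
      · rcases hfit with ⟨-, hall⟩ | ⟨h7, -, hbest⟩
        · exact absurd hmf (not_le.2 (hall m hm))
        · have hlt : σ.last (σ.var 7) < σ.last k := by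
            rw [hbetter]
            by_contra hn
            simp [Expr.eval, h5, h7, hH.v3, hn] at hb
          exact (hbest m hm hmf).trans hlt.le
      · exact le_rfl
  · refine Ends.skip (hfin σ hH h5 h6 ?_)
    by_cases hkf : I.s j < σ.last k
    · refine hfit.imp (fun h => ⟨h.1, fun m hm => ?_⟩) fun h => ⟨h.1, h.2.1, fun m hm hmf => ?_⟩
      · rcases Nat.lt_succ_iff_lt_or_eq.1 hm with hm | rfl
        exacts [h.2 m hm, hkf]
      · rcases Nat.lt_succ_iff_lt_or_eq.1 hm with hm | rfl
        exacts [h.2.2 m hm hmf, absurd hmf (not_le.2 hkf)]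
    · have hkf' := hkf
      rw [hfree] at hkf'
      rcases hfit with ⟨h7, -⟩ | ⟨h7, h7f, hbest⟩
      · simp [Expr.eval, h5, h6, h7, hH.v3, hH.a0, hH.a1, toArr_coe, hkf'] at hb
      · refine Or.inr ⟨h7, h7f, fun m hm hmf => ?_⟩
        rcases Nat.lt_succ_iff_lt_or_eq.1 hm with hm | rfl
        · exact hbest m hm hmf
        · rw [← not_lt, hbetter]
          intro hlt
          simp [Expr.eval, h5, h6, hH.a0, hH.a1, toArr_coe, hkf', hlt] at hb

theorem Fitting.bestFit (h : Fitting I Max K L x A g j K σ) :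
    (σ.var 7 = K ∧ I.BestFit K A g j ∅) ∨ (σ.var 7 < K ∧ I.BestFit K A g j {σ.var 7}) := by
  obtain ⟨hH, -, -, hfit⟩ := h
  have hs := I.s_nonneg j
  refine hfit.imp (fun h => ⟨h.1, Or.inl ⟨rfl, fun m hm => ?_⟩⟩)
    fun h => ⟨h.1, Or.inr ⟨_, h.1, rfl, ?_, fun m hm hmf τ hmτ => ?_⟩⟩
  · exact (hH.last m hm _ hs).2 (h.2 m hm)
  · rw [hH.last _ h.1 _ hs, not_lt]
    exact h.2.1
  · rw [hH.last m hm _ hs, not_lt] at hmf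
    have hle := h.2.2 m hm hmf
    -- `Holds.last` speaks only of times `τ ≥ 0`. All end times are positive, so a negative `τ` may
    -- be replaced by `0`.
    have hmax : m ∈ I.busy A g (max τ 0) := by
      obtain ⟨i, hi, hiτ, hmi⟩ := mem_busy.1 hmτ
      exact mem_busy.2 ⟨i, hi, max_lt hiτ ((I.s_nonneg i).trans_lt (I.s_lt_e i)), hmi⟩
    rw [hH.last m hm _ (le_max_right _ _)] at hmax
    exact I.busy_anti A g (le_max_left τ 0)
      ((hH.last _ h.1 _ (le_max_right _ _)).2 (hmax.trans_le hle))

/-- All steps of `processJob` but the choice of the job and of the machine. -/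
theorem Holds.insert (hU : I.IsUniform Max) (hdvd : Max ∣ I.W)
    (hK : K = min (I.W / Max) n) (hH : Holds I Max K L x A g σ) (hj : j ∉ A)
    (hmin : ∀ i, i ∉ A → I.e j ≤ I.e i) {B : Finset ℕ} (hB : I.BestFit K A g j B) {τ : State}
    (hfits : Fits L τ) (hvar : ∀ y < 4, τ.var y = σ.var y) (h4 : τ.var 4 = A.card + 1)
    (harr : ∀ a < 4, τ.arr a = σ.arr a) (h6 : τ.arr 6 = Function.update (σ.arr 6) j 1)
    (hlast : ∀ m, τ.last m = if m ∈ B then I.e j else σ.last m)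
    (hout : output n τ j = blocks Max (fun _ => B) j)
    (hout' : ∀ i, i ≠ j → output n τ i = output n σ i) :
    Holds I Max K L x (insert j A) (Function.update g j B) τ where
  fits := hfits
  v0 := (hvar 0 (by decide)).trans hH.v0
  v2 := (hvar 2 (by decide)).trans hH.v2
  v3 := (hvar 3 (by decide)).trans hH.v3
  v4 := by rw [h4, Finset.card_insert_of_notMem hj]
  a0 := (harr 0 (by decide)).trans hH.a0
  a1 := (harr 1 (by decide)).trans hH.a1
  a2 := (harr 2 (by decide)).trans hH.a2
  a3 := (harr 3 (by decide)).trans hH.a3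
  marks i := by
    rw [h6, Function.update_apply]
    by_cases h : i = j
    · simp [h]
    · simp [h, Fin.val_inj, hH.marks]
  last m hm τ' hτ := by
    have hstep : m ∈ I.busy (Insert.insert j A) (Function.update g j B) τ' ↔
        (τ' < I.e j ∧ m ∈ B) ∨ m ∈ I.busy A g τ' := by
      rw [← busy_congr (c := Function.update g j B) (c' := g) (A := A)]
      · simp [mem_busy]
      · intro i hi
        exact Function.update_of_ne (by rintro rfl; exact hj hi) _ _
    rw [hstep, hlast]
    split_ifs with hmB
    -- Overwriting the old end time of the machine is right, since `j` ends no earlier than any job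
    -- of `A`.
    · refine ⟨?_, fun h => Or.inl ⟨h, hmB⟩⟩
      rintro (h | h)
      · exact h.1
      · obtain ⟨i, hi, hi', -⟩ := mem_busy.1 h
        exact hi'.trans_le (hH.greedy.sorted i hi j hj)
    · simp [hmB, hH.last m hm τ' hτ]
  out i := by
    by_cases h : i = j
    · subst h
      rw [hout]
      simp [blocks]
    · rw [hout' i h, hH.out]
      simp [blocks, Function.update_of_ne h]
  greedy := hH.greedy.step hU hdvd hK hj hmin hB

theorem processJob_ends (hx : x.Represents I Max) (hU : I.IsUniform Max) (hdvd : Max ∣ I.W)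
    (hK : K = min (I.W / Max) n) (hA : A.card < n) (hH : Holds I Max K L x A g σ)
    (hW : I.W.size ≤ L) :
    Ends processJob σ ((8 * n + 18) * unitCost L) fun τ =>
      ∃ A' g', A'.card = A.card + 1 ∧ Holds I Max K L x A' g' τ := by
  have hKn : K ≤ n := hK.trans_le (min_le_right _ _)
  have hn1 : Nat.size 1 ≤ L := hH.size_le (by omega)
  -- The pieces add up to `4 * n + 4 * K + 18` units, and `K ≤ n`.
  refine Ends.mono (T := unitCost L + (unitCost L +
    ((n * (3 * unitCost L + unitCost L) + unitCost L) + (unitCost L + (unitCost L +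
    ((K * (3 * unitCost L + unitCost L) + unitCost L) +
    ((unitCost L + (2 * unitCost L + (2 * unitCost L + (2 * unitCost L + 2 * unitCost L)))) +
    (2 * unitCost L + unitCost L)))))))) ?_ ?_ fun _ h => h
  swap
  · have := Nat.mul_le_mul_right (unitCost L) hKn
    linarith
  refine Ends.seq (Ends.assign hH.fits (by decide) ?_)
  have hH1 := hH.setVar (y := 5) (v := (Expr.const 0).eval σ) le_rfl (by simp [Expr.eval])
  refine Ends.seq (Ends.assign hH1.fits (by decide) ?_)
  have hH2 := hH1.setVar (y := 6) (v := (Expr.var 0).eval (σ.setVar 5 ((Expr.const 0).eval σ)))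
    (by decide) (hH1.fits.1 0)
  refine Ends.seq (Ends.mono (Ends.loop (Selecting I Max K L x A g) (fun _ _ h => h.1.fits)
    (by decide) ?_ (fun k σ hk h => selectStep_ends hx hk h) ⟨hH2, ?_, Or.inl ⟨?_, ?_⟩⟩) le_rfl ?_)
  · rintro k ρ ⟨h, h5, -⟩
    simp [Expr.eval, h5, h.v0]
  · rw [setVar_var_of_ne _ _ (by decide), setVar_var_self]; rfl
  · rw [setVar_var_self]; exact hH1.v0
  · exact fun i hi => absurd hi (Nat.not_lt_zero _)
  clear hH1 hH2 hH
  rintro σ ⟨hH, -, hsel⟩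
  obtain ⟨j, h6, hj, hmin⟩ : ∃ j : Fin n, σ.var 6 = j ∧ j ∉ A ∧ ∀ i, i ∉ A → I.e j ≤ I.e i := by
    rcases hsel with ⟨-, hall⟩ | ⟨j, h6, hj, hmin⟩
    · have : A = Finset.univ := Finset.eq_univ_iff_forall.2 fun i => hall i i.2
      rw [this, Finset.card_univ, Fintype.card_fin] at hA
      exact absurd hA (lt_irrefl _)
    · exact ⟨j, h6, hj, fun i => hmin i i.2⟩
  refine Ends.seq (Ends.assign hH.fits (by decide) ?_)
  have hH1 := hH.setVar (y := 5) (v := (Expr.const 0).eval σ) le_rfl (by simp [Expr.eval])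
  refine Ends.seq (Ends.assign hH1.fits (by decide) ?_)
  have hH2 := hH1.setVar (y := 7) (v := (Expr.var 3).eval (σ.setVar 5 ((Expr.const 0).eval σ)))
    (by decide) (hH1.fits.1 3)
  refine Ends.seq (Ends.mono (Ends.loop (Fitting I Max K L x A g j) (fun _ _ h => h.1.fits)
    (by decide) ?_ (fun k σ hk h => fitStep_ends hx hKn hk h)
    ⟨hH2, ?_, ?_, Or.inl ⟨?_, ?_⟩⟩) le_rfl ?_)
  · rintro k ρ ⟨h, h5, -⟩
    simp [Expr.eval, h5, h.v3]
  · rw [setVar_var_of_ne _ _ (by decide), setVar_var_self]; rfl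
  · rwa [setVar_var_of_ne _ _ (by decide), setVar_var_of_ne _ _ (by decide)]
  · rw [setVar_var_self]; exact hH1.v3
  · exact fun i hi => absurd hi (Nat.not_lt_zero _)
  clear hH1 hH2 hsel hH h6 σ
  intro σ hF
  have h6 := hF.2.2.1
  have hH := hF.1
  have hbf := hF.bestFit
  have hcard := Finset.card_insert_of_notMem hj
  have hval : ∀ i : Fin n, i ≠ j → (i : ℕ) ≠ j := fun i h => Fin.val_ne_of_ne h
  refine Ends.seq (Ends.ite hH.fits (by decide) (fun hb => ?_) fun hb => ?_)
  · have h7 : σ.var 7 < K := by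
      by_contra hn
      simp [Expr.eval, hH.v3, hn] at hb
    have hB : I.BestFit K A g j {σ.var 7} := by
      rcases hbf with h | h
      · omega
      · exact h.2
    -- The first color of a block is at most `W`, because `Max ≥ 1`.
    have hsize : (σ.var 7 * Max + 1).size ≤ L := by
      refine (Nat.size_le_size ?_).trans hW
      have h1 : σ.var 7 + 1 ≤ I.W / Max := h7.trans_le (hK.trans_le (min_le_left _ _))
      have h2 := (Nat.mul_le_mul_right Max h1).trans (Nat.div_mul_le_self I.W Max)
      rw [add_mul, one_mul] at h2
      have := hU.1
      omega
    have f1 := hH.fits.setArr 7 (σ.var 7) (hH.fits.2 2 (σ.var 6))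
    refine Ends.seq (Ends.store hH.fits (by decide) (by decide) ?_)
    have f2 := f1.setArr 8 (σ.var 7)
      ((Nat.size_le_size (Nat.sub_le (σ.arr 3 (σ.var 6)) 1)).trans (hH.fits.2 3 (σ.var 6)))
    refine Ends.seq (Ends.store f1 (by decide) (by decide) ?_)
    have f3 := f2.setArr 4 (σ.var 6) hsize
    refine Ends.seq (Ends.store f2 (by decide) (by decide) ?_)
    have f4 := f3.setArr 5 (σ.var 6) (hH.fits.1 2)
    refine Ends.store (L := L) ?_ (by decide) (by decide) ?_
    · simpa [Expr.eval, State.setArr, hH.v2] using f3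
    have f5 := f4.setArr 6 (σ.var 6) hn1
    refine Ends.seq (Ends.store (L := L) ?_ (by decide) (by decide) ?_)
    · simpa [Expr.eval, State.setArr, hH.v2] using f4
    refine Ends.assign (L := L) ?_ (by decide) ?_
    · simpa [Expr.eval, State.setArr, hH.v2] using f5
    refine ⟨insert j A, _, hcard, Holds.insert hU hdvd hK hH hj hmin hB ?_ ?_ ?_ ?_ ?_ ?_ ?_ ?_⟩
    · have := f5.setVar 4 (hH.size_le (v := A.card + 1) hA)
      simpa [Expr.eval, State.setArr, State.setVar, hH.v2, hH.v4] using this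
    · intro y hy
      rw [setVar_var_of_ne _ _ (by omega)]; rfl
    · simp [Expr.eval, State.setArr, State.setVar, hH.v4]
    · intro a ha
      interval_cases a <;> simp [State.setArr, State.setVar]
    · simp [Expr.eval, State.setArr, State.setVar, h6]
    · intro m
      by_cases hm : m = σ.var 7
      · subst hm
        -- Denominators are stored minus one; nothing is lost, as they are nonzero.
        have hden : (x.eDen j - 1 + 1 : ℕ) = x.eDen j :=
          Nat.sub_add_cancel (Nat.one_le_iff_ne_zero.2 (hx.2.2.2 j).1)
        rw [if_pos (Finset.mem_singleton_self _), (hx.2.2.2 j).2, ← hden]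
        simp [State.last, Expr.eval, State.setArr, State.setVar, h6, hH.a2, hH.a3, toArr_coe]
      · rw [if_neg (by simpa using hm)]
        simp [State.last, Expr.eval, State.setArr, State.setVar, hm]
    · simp [output, blocks, Expr.eval, State.setArr, State.setVar, h6, hH.v2]
    · intro i hi
      simp [output, Expr.eval, State.setArr, State.setVar, h6, hval i hi]
  · have h7 : ¬ σ.var 7 < K := by
      intro hlt
      simp [Expr.eval, hH.v3, hlt] at hb
    have hB : I.BestFit K A g j ∅ := by
      rcases hbf with h | h
      · exact h.2
      · exact absurd h.1 h7
    refine Ends.mono (Ends.skip (L := L) ?_) (by omega) fun _ h => h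
    have f1 := hH.fits.setArr 6 (σ.var 6) hn1
    refine Ends.seq (Ends.store hH.fits (by decide) (by decide) ?_)
    refine Ends.assign f1 (by decide) ?_
    refine ⟨insert j A, _, hcard, Holds.insert hU hdvd hK hH hj hmin hB ?_ ?_ ?_ ?_ ?_ ?_ ?_ ?_⟩
    · have := f1.setVar 4 (hH.size_le (v := A.card + 1) hA)
      simpa [Expr.eval, State.setArr, State.setVar, hH.v4] using this
    · intro y hy
      rw [setVar_var_of_ne _ _ (by omega)]; rfl
    · simp [Expr.eval, State.setArr, State.setVar, hH.v4]
    · intro a ha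
      interval_cases a <;> simp [State.setArr, State.setVar]
    · simp [Expr.eval, State.setArr, State.setVar, h6]
    · intro m
      simp [State.last, State.setArr, State.setVar]
    -- The output cells of a rejected job are untouched and already describe an empty block.
    · have h := hH.out j
      rw [blocks, hH.greedy.supp j hj] at h
      simpa [output, blocks, State.setArr, State.setVar] using h
    · intro i hi
      simp [output, State.setArr, State.setVar]

theorem Input.init_fits (x : Input n) : Fits x.size x.init := by
  refine ⟨fun y => ?_, fun a i => ?_⟩
  · simp only [Input.init, Input.size]
    split
    all_goals first | omega | simp
  · have key : ∀ f : Fin n → ℕ, (∀ i, (f i).size ≤ ((x.sNum i).size + 1) +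
        ((x.sDen i).size + 1) + ((x.eNum i).size + 1) + ((x.eDen i).size + 1)) →
        (Input.toArr f i).size ≤ x.size := by
      intro f hf
      unfold Input.toArr
      split_ifs with hi
      · have := Finset.single_le_sum (f := fun i => ((x.sNum i).size + 1) +
          ((x.sDen i).size + 1) + ((x.eNum i).size + 1) + ((x.eDen i).size + 1))
          (fun i _ => Nat.zero_le _) (Finset.mem_univ ⟨i, hi⟩)
        have := hf ⟨i, hi⟩
        simp only [Input.size] at *
        omega
      · simp
    simp only [Input.init]
    split
    all_goals first | exact key _ fun i => by omega | simp

theorem Input.le_size (x : Input n) : n ≤ x.size := by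
  have h : ∑ _i : Fin n, 1 ≤ ∑ i, (((x.sNum i).size + 1) + ((x.sDen i).size + 1) +
      ((x.eNum i).size + 1) + ((x.eDen i).size + 1)) :=
    Finset.sum_le_sum fun i _ => by omega
  rw [Finset.sum_const, Finset.card_univ, Fintype.card_fin, smul_eq_mul, mul_one] at h
  unfold Input.size
  omega

theorem greedyProgram_ends (hx : x.Represents I Max) (hU : I.IsUniform Max) (hdvd : Max ∣ I.W) :
    Ends greedyProgram x.init ((n * (8 * n + 19) + 4) * unitCost x.size) fun τ =>
      I.FSAPOptimal (output n τ) := by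
  set L := x.size with hL
  have hf : Fits L x.init := x.init_fits
  have hW : I.W.size ≤ L := hx.1 ▸ hf.1 1
  have hdiv : (I.W / Max).size ≤ L := (Nat.size_le_size (Nat.div_le_self _ _)).trans hW
  have hv0 : x.init.var 0 = n := rfl
  have hv1 : x.init.var 1 = I.W := hx.1
  have hv2 : x.init.var 2 = Max := hx.2.1
  obtain ⟨K, hK⟩ : ∃ K, K = min (I.W / Max) n := ⟨_, rfl⟩
  have hfK : Fits L (x.init.setVar 3 K) := by
    refine hf.setVar 3 (le_trans (Nat.size_le_size ?_) hdiv)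
    omega
  have h0 : Holds I Max K L x ∅ (fun _ => ∅) (x.init.setVar 3 K) := by
    refine ⟨hfK, rfl, hv2, rfl, rfl, rfl, rfl, rfl, rfl, fun i => rfl, fun m hm τ hτ => ?_,
      fun i => ?_, Greedy.empty I Max K⟩
    -- Zeroed memory reads as the end time `0 / 1`, so every machine is free at each `τ ≥ 0`.
    · simpa [mem_busy, State.last, State.setVar, Input.init] using hτ
    · simp [output, State.setVar, Input.init, blocks]
  refine Ends.mono (T := unitCost L + ((unitCost L + unitCost L) +
    (n * ((8 * n + 18) * unitCost L + unitCost L) + unitCost L))) ?_ (by nlinarith) fun _ h => h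
  refine Ends.seq (Ends.assign hf (by decide) ?_)
  have he : (Expr.div (.var 1) (.var 2)).eval x.init = I.W / Max := by simp [Expr.eval, hv1, hv2]
  rw [he]
  have hf1 := hf.setVar 3 hdiv
  have hmain : Ends (.loop (.lt (.var 4) (.var 0)) processJob) (x.init.setVar 3 K)
      (n * ((8 * n + 18) * unitCost L + unitCost L) + unitCost L)
      fun τ => I.FSAPOptimal (output n τ) := by
    refine Ends.mono (Ends.loop (fun k σ => ∃ A g, A.card = k ∧ Holds I Max K L x A g σ)
      ?_ (by decide) ?_ ?_ ⟨∅, _, rfl, h0⟩) le_rfl ?_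
    · rintro k σ ⟨A, g, -, h⟩
      exact h.fits
    · rintro k σ ⟨A, g, rfl, h⟩
      simp [Expr.eval, h.v4, h.v0]
    · rintro k σ hk ⟨A, g, rfl, h⟩
      exact processJob_ends hx hU hdvd hK hk h hW
    · rintro τ ⟨A, g, hA, h⟩
      have hA' : A = Finset.univ := Finset.eq_univ_of_card A (by simpa using hA)
      subst hA'
      rw [funext h.out]
      exact h.greedy.fsapOptimal hU hK
  have hv3 : (x.init.setVar 3 (I.W / Max)).var 3 = I.W / Max := setVar_var_self _ _ _
  have hv0' : (x.init.setVar 3 (I.W / Max)).var 0 = n := rfl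
  refine Ends.seq (Ends.ite hf1 (by decide) (fun hb => ?_) fun hb => ?_)
  · refine Ends.assign hf1 (by decide) ?_
    have hlt : n < I.W / Max := by
      by_contra hn
      simp [Expr.eval, hv3, hv0', hn] at hb
    have hKn : K = n := by omega
    have : (x.init.setVar 3 (I.W / Max)).setVar 3
        ((Expr.var 0).eval (x.init.setVar 3 (I.W / Max))) = x.init.setVar 3 K := by
      simp only [Expr.eval, hv0', hKn]
      simp [State.setVar]
    rwa [this]
  · have hle : ¬ n < I.W / Max := by
      intro hlt
      simp [Expr.eval, hv3, hv0', hlt] at hb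
    have hKW : K = I.W / Max := by omega
    rw [← hKW]
    exact Ends.skip hmain

end Ram

theorem mainTheorem6 :
    (∀ (n : ℕ) (I : AllocInstance n) (Max : ℕ), I.IsUniform Max → Max ∣ I.W →
      (∃ c, I.FBAPOptimal c ∧ ∀ i, (c i).card = 0 ∨ (c i).card = Max) ∧
      ∀ S : Finset (Fin n), I.MaxColorableSet (I.W / Max) S →
        (∃ c, I.FSAPFeasible c ∧ ∀ i, (c i).card = if i ∈ S then Max else 0) ∧
        ∀ c, I.FSAPFeasible c → (∀ i, (c i).card = if i ∈ S then Max else 0) →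
          I.FSAPOptimal c ∧ I.FBAPOptimal c) ∧
    ∃ (prog : Ram.Cmd) (P : Polynomial ℕ),
      ∀ (n : ℕ) (I : AllocInstance n) (Max : ℕ), I.IsUniform Max → Max ∣ I.W →
        ∀ x : Ram.Input n, x.Represents I Max →
          ∃ (t : ℕ) (σ : Ram.State), Ram.Run prog x.init t σ ∧ t ≤ P.eval x.size ∧
            I.FSAPOptimal (Ram.output n σ) := by
  refine ⟨fun n I Max hU hdvd => ⟨?_, fun S hS =>
    ⟨hS.1.exists_fsapFeasible hU, fun c hc hcard => hS.optimal hU hdvd hc hcard⟩⟩,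
    Ram.greedyProgram,
    -- The bound of `greedyProgram_ends` with `n` replaced by the input length, which is at least
    -- `n`; the last factor is `unitCost`.
    (.X * (8 * .X + 19) + 4) * (4000 * (.X + 1)), fun n I Max hU hdvd x hx => ?_⟩
  · obtain ⟨S, hS⟩ := I.exists_maxColorableSet (I.W / Max)
    obtain ⟨c, hc, hcard⟩ := hS.1.exists_fsapFeasible hU
    refine ⟨c, (hS.optimal hU hdvd hc hcard).2, fun i => ?_⟩
    rw [hcard i]
    split_ifs
    exacts [Or.inr rfl, Or.inl rfl]
  · refine Ram.Ends.mono (Ram.greedyProgram_ends hx hU hdvd) ?_ fun _ h => h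
    have hn := x.le_size
    simp only [Polynomial.eval_mul, Polynomial.eval_add, Polynomial.eval_X, Polynomial.eval_ofNat,
      Polynomial.eval_one, Ram.unitCost]
    gcongr
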